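/- **Theorem (Gaussian ensembles and flag manifolds).** Let $\mathbb F$ be $\mathbb R$, $\mathbb C$ or $\mathbb H$, let $\beta=\dim_{\mathbb R}\mathbb F\in\{1,2,4\}$, and let $G=\{Q\in\mathbb F^{n\times n}: Q^{\mathsf H}Q=I\}$, that is, $G=\mathrm O(n)$, $\mathrm U(n)$ or $\mathrm{Sp}(n)$ respectively. Let $\mathcal S=\{X\in\mathbb F^{n\times n}:X=X^{\mathsf H}\}$, and let $\mathcal S_\times\subseteq\mathcal S$ be the set of those $X\in\mathcal S$ whose $n$ (real) eigenvalues are distinct. The Gaussian ensemble over $\mathbb F$ (called $\mathrm{GOE}(n)$, $\mathrm{GUE}(n)$, $\mathrm{GSE}(n)$ for $\mathbb F=\mathbb R,\mathbb C,\mathbb H$) is the probability distribution on $\mathcal S$ with density $$2^{-n/2}\,\pi^{-\beta n(n-1+2/\beta)/4}\,e^{-\operatorname{tr}(X^2)/2}$$ with respect to Lebesgue measure in the real diagonal entries $x_{ii}$ and the real components of the entries $x_{ij}$, $i<j$. Let $0<k_1<\dots<k_p<n$ be integers, $k_0=0$, $k_{p+1}=n$, let $a_1,\dots,a_{p+1}$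 be distinct real numbers, and put $\Delta_a=\operatorname{diag}(a_1I_{k_1-k_0},\dots,a_{p+1}I_{k_{p+1}-k_p})$. The flag manifold is identified with the set of matrices $$\mathrm{Flag}(k_1,\dots,k_p,\mathbb F^n)=\{Q\Delta_aQ^{\mathsf H}:Q\in G\},$$ on which $A\in G$ acts by $Y\mapsto AYA^{\mathsf H}$. Then: 1. Every $X\in\mathcal S_\times$ has an eigenvalue decomposition $X=Q\Lambda Q^{\mathsf H}$ with $Q\in G$ and $\Lambda=\operatorname{diag}(\lambda_1,\dots,\lambda_n)$ real, $\lambda_1>\dots>\lambda_n$, and $\varphi(X):=Q\Delta_aQ^{\mathsf H}$ does not depend on its choice. So $\varphi:\mathcal S_\times\to\mathrm{Flag}(k_1,\dots,k_p,\mathbb F^n)$ is well defined. 2. A random matrix $X$ distributed as the Gaussian ensemble over $\mathbb F$ lies in $\mathcal S_\times$ almost surely. 3. There is exactly one $G$-invariant Borel probability measure on $\mathrm{Flag}(k_1,\dots,k_p,\mathbb F^n)$, its uniform distribution, and if $X$ is a random matrix distributed as the Gaussian ensemble over $\mathbb F$, then $\varphi(X)$ is distributed as this uniform distribution. Thus $X\sim\mathrm{GOE}(n)$,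 $\mathrm{GUE}(n)$, $\mathrm{GSE}(n)$ implies that $\varphi(X)$ is uniformly distributed on $\mathrm{Flag}(k_1,\dots,k_p,\mathbb R^n)$, $\mathrm{Flag}(k_1,\dots,k_p,\mathbb C^n)$, $\mathrm{Flag}(k_1,\dots,k_p,\mathbb H^n)$, respectively. -/

import Mathlib

open MeasureTheory ProbabilityTheory Matrix
open scoped Quaternion

/-- The Borel σ-algebra on the quaternions. -/
noncomputable instance Quaternion.instMeasurableSpaceReal : MeasurableSpace ℍ[ℝ] := borel ℍ[ℝ]

instance Quaternion.instBorelSpaceReal : BorelSpace ℍ[ℝ] := ⟨rfl⟩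

instance Quaternion.instStarModuleReal : StarModule ℝ ℍ[ℝ] :=
  ⟨fun r x => by ext <;> simp⟩

/-- The Borel σ-algebra on square matrices (entrywise topology). -/
instance Matrix.instMeasurableSpaceBorel {n : ℕ} {F : Type*} [TopologicalSpace F] :
    MeasurableSpace (Matrix (Fin n) (Fin n) F) := borel _

instance Matrix.instBorelSpaceBorel {n : ℕ} {F : Type*} [TopologicalSpace F] :
    BorelSpace (Matrix (Fin n) (Fin n) F) := ⟨rfl⟩

namespace GaussianFlag

noncomputable section

/-! The definitions are made once for a finite-dimensional real normed division algebra `F` with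
involution and inner product; they are used only for `F = ℝ`, `ℂ`, `ℍ[ℝ]`, where the involution
is conjugation and the inner product is the standard one. -/

section Definitions

variable (n : ℕ) (F : Type*) [NormedDivisionRing F] [StarRing F] [InnerProductSpace ℝ F]

/-- `S²(ℝⁿ)`, `H²(ℂⁿ)`, `Q²(ℍⁿ)`: the `n × n` matrices with `X = Xᴴ`. -/
abbrev SelfAdj : Type _ := selfAdjoint (Matrix (Fin n) (Fin n) F)

/-- `O(n)`, `U(n)`, `Sp(n)`: the `n × n` matrices with `Qᴴ Q = Q Qᴴ = I`. -/
abbrev UnitaryGp : Type _ := unitary (Matrix (Fin n) (Fin n) F)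

variable {n F}

/-- The real diagonal matrix `diag(x₁, …, xₙ)`, as a matrix over `F`. -/
def realDiag (x : Fin n → ℝ) : Matrix (Fin n) (Fin n) F :=
  Matrix.diagonal fun i => x i • (1 : F)

section Ensemble

variable [StarModule ℝ F]

/-- The self-adjoint matrix with diagonal entries `d i` and entries `u (i, j)` for `i < j`. -/
def ofCoords (c : (Fin n → ℝ) × ({q : Fin n × Fin n // q.1 < q.2} → F)) : SelfAdj n F :=
  ⟨Matrix.of fun i j =>
      if h : i < j then c.2 ⟨(i, j), h⟩
      else if h' : j < i then star (c.2 ⟨(j, i), h'⟩)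
      else c.1 i • (1 : F), by
    rw [selfAdjoint.mem_iff]
    ext i j
    rw [Matrix.star_apply]
    rcases lt_trichotomy i j with h | h | h
    · simp [h, h.not_gt]
    · subst h; simp
    · simp [h, h.not_gt]⟩

variable [FiniteDimensional ℝ F] [MeasurableSpace F] [BorelSpace F]

variable (n F)

/-- Lebesgue measure on the self-adjoint matrices: the product of the Lebesgue measures in the
real diagonal entries and in the (real components of the) entries above the diagonal. -/
def lebesgue : Measure (SelfAdj n F) :=
  Measure.map ofCoords
    (volume : Measure ((Fin n → ℝ) × ({q : Fin n × Fin n // q.1 < q.2} → F)))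

variable {n F}

/-- The density `2^{-n/2} π^{-βn(n-1+2/β)/4} exp(-tr(X²)/2)`, with `β = dim_ℝ F`. The trace of
`X²` is real for self-adjoint `X`; `inner ℝ 1 t` is the real part of `t`. -/
def gaussianDensity (X : SelfAdj n F) : ℝ :=
  let β : ℝ := Module.finrank ℝ F
  (2 : ℝ) ^ (-(n : ℝ) / 2) * Real.pi ^ (-(β * n * (n - 1 + 2 / β)) / 4) *
    Real.exp (-(inner ℝ (1 : F) (Matrix.trace (X.1 * X.1))) / 2)

variable (n F)

/-- The Gaussian ensemble of self-adjoint `n × n` matrices over `F`. -/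
def gaussianEnsemble : Measure (SelfAdj n F) :=
  (lebesgue n F).withDensity fun X => ENNReal.ofReal (gaussianDensity X)

end Ensemble

variable (n F)

/-- Self-adjoint matrices all of whose eigenvalues are distinct, that is, with `n` distinct (real)
eigenvalues. -/
def simpleSpectrum : Set (SelfAdj n F) :=
  {X | {r : ℝ | ∃ v : Fin n → F, v ≠ 0 ∧ X.1 *ᵥ v = r • v}.ncard = n}

variable {n F}

/-- `X = Q Λ Qᴴ` with `Q` in `O(n)`, `U(n)` or `Sp(n)` and `Λ = diag(λ₁, …, λₙ)` real,
`λ₁ > ⋯ > λₙ`. -/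
def IsOrderedEigendecomposition (X : SelfAdj n F) (Q : UnitaryGp n F) (l : Fin n → ℝ) : Prop :=
  StrictAnti l ∧ X.1 = Q.1 * realDiag l * Q.1ᴴ

variable {p : ℕ}

/-- The (zero-based) block containing `i` when `{0, …, n-1}` is cut at `k₁ < ⋯ < k_p`: the number
of `j` with `k_j ≤ i`. -/
def block (k : Fin p → ℕ) (i : Fin n) : Fin (p + 1) :=
  ⟨(Finset.univ.filter fun j => k j ≤ i.1).card,
    Nat.lt_succ_of_le ((Finset.card_filter_le _ _).trans (by simp))⟩

/-- `Δ_a = diag(a₁ I_{k₁}, a₂ I_{k₂-k₁}, …, a_{p+1} I_{n-k_p})`. -/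
def Delta (k : Fin p → ℕ) (a : Fin (p + 1) → ℝ) : Matrix (Fin n) (Fin n) F :=
  realDiag fun i => a (block k i)

variable (n F)

/-- The flag manifold `Flag(k₁, …, k_p, Fⁿ)` as the set of matrices `Q Δ_a Qᴴ`. -/
def Flag (k : Fin p → ℕ) (a : Fin (p + 1) → ℝ) : Set (Matrix (Fin n) (Fin n) F) :=
  Set.range fun Q : UnitaryGp n F => Q.1 * Delta k a * Q.1ᴴ

variable {n F}

/-- The point `Q Δ_a Qᴴ` of the flag manifold. -/
def Flag.mk (k : Fin p → ℕ) (a : Fin (p + 1) → ℝ) (Q : UnitaryGp n F) : Flag n F k a :=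
  ⟨Q.1 * Delta k a * Q.1ᴴ, Q, rfl⟩

/-- The action `Y ↦ A Y Aᴴ` of the group on the flag manifold. -/
def Flag.conj {k : Fin p → ℕ} {a : Fin (p + 1) → ℝ} (A : UnitaryGp n F) (Y : Flag n F k a) :
    Flag n F k a :=
  ⟨A.1 * Y.1 * A.1ᴴ, by
    obtain ⟨Q, hQ⟩ := Y.2
    refine ⟨A * Q, ?_⟩
    simp only [Submonoid.coe_mul, ← hQ, Matrix.conjTranspose_mul, Matrix.mul_assoc]⟩

/-- Probability measures on the flag manifold that are invariant under `O(n)`, `U(n)`, `Sp(n)`. -/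
def IsInvariantDistribution {k : Fin p → ℕ} {a : Fin (p + 1) → ℝ}
    (ν : Measure (Flag n F k a)) : Prop :=
  IsProbabilityMeasure ν ∧ ∀ A : UnitaryGp n F, ν.map (Flag.conj A) = ν

/-- `ν` is the uniform distribution on the flag manifold: the unique invariant distribution. -/
def IsUniformDistribution {k : Fin p → ℕ} {a : Fin (p + 1) → ℝ}
    (ν : Measure (Flag n F k a)) : Prop :=
  IsInvariantDistribution ν ∧ ∀ ν' : Measure (Flag n F k a), IsInvariantDistribution ν' → ν' = ν

open Classical in
/-- The map `φ : X ↦ Q Δ_a Qᴴ`, where `X = Q Λ Qᴴ` with strictly decreasing eigenvalues. It is only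
meaningful on matrices with simple spectrum; elsewhere it takes the irrelevant value `Δ_a`. -/
def phi (k : Fin p → ℕ) (a : Fin (p + 1) → ℝ) (X : SelfAdj n F) : Flag n F k a :=
  if h : ∃ Q : UnitaryGp n F, ∃ l : Fin n → ℝ, IsOrderedEigendecomposition X Q l then
    Flag.mk k a h.choose
  else Flag.mk k a 1

end Definitions

/-- The Gaussian Orthogonal Ensemble. -/
def GOE (n : ℕ) : Measure (SelfAdj n ℝ) := gaussianEnsemble n ℝ

/-- The Gaussian Unitary Ensemble. -/
def GUE (n : ℕ) : Measure (SelfAdj n ℂ) := gaussianEnsemble n ℂ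

/-- The Gaussian Symplectic Ensemble. -/
def GSE (n : ℕ) : Measure (SelfAdj n ℍ[ℝ]) := gaussianEnsemble n ℍ[ℝ]

end

end GaussianFlag

set_option linter.unusedSectionVars false

namespace GaussianFlag

/-! Everything rests on equivariance: if X = QΛQᴴ then AXAᴴ = (AQ)Λ(AQ)ᴴ, so `phi` intertwines
conjugation of self-adjoint matrices with the action on the flag manifold. The Gaussian law is
invariant under conjugation, hence so is its image, and a transitive action of a compact group has
only one invariant probability measure.

Four facts carry this. (a) `IsOrderedEigendecomposition.mk_eq_mk`: a matrix commuting with a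
diagonal Λ with distinct real entries is diagonal, hence commutes with `Delta k a`. (b)
`ae_lebesgue_mem_simpleSpectrum`: X has simple spectrum once the determinant of (Re tr X^{i+j}) is
nonzero, and on every line in a suitable direction that determinant vanishes at only finitely many
points. (c) `measurePreserving_conjSelfAdj`: by uniqueness of Haar measure, conjugation scales
Lebesgue measure by a constant, which is 1 because some compact neighbourhood of 0 is invariant. (d)
`IsInvariantDistribution.eq_map`: averaging over the group determines an invariant measure.

The three algebras are treated together. Since ℍ is not commutative, only real eigenvalues are used,
and the trace enters only through its real part. -/

/-- A real normed division algebra whose involution is conjugation and whose inner product is the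
standard one. -/
class StandardInvolution (F : Type*) [NormedDivisionRing F] [StarRing F] [InnerProductSpace ℝ F] :
    Prop extends IsScalarTower ℝ F F, SMulCommClass ℝ F F where
  star_mul_self' : ∀ a : F, star a * a = (‖a‖ ^ 2) • (1 : F)
  inner_eq_inner_one : ∀ a b : F, inner ℝ a b = inner ℝ 1 (star a * b)
  inner_one_mul_comm : ∀ a b : F, inner ℝ 1 (a * b) = inner ℝ 1 (b * a)

instance : StandardInvolution ℝ where
  star_mul_self' a := by simp [sq]
  inner_eq_inner_one a b := by simp [mul_comm]
  inner_one_mul_comm a b := by rw [mul_comm]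

instance : StandardInvolution ℂ where
  star_mul_self' a := by
    rw [Complex.real_smul, mul_one, Complex.ofReal_pow, ← Complex.conj_mul']
    rfl
  inner_eq_inner_one a b := by simp [Complex.inner, mul_comm]
  inner_one_mul_comm a b := by rw [mul_comm]

instance : StandardInvolution ℍ[ℝ] where
  star_mul_self' a := by
    rw [Quaternion.star_mul_self, Quaternion.normSq_eq_norm_mul_self, ← sq,
      ← Quaternion.coe_mul_eq_smul, mul_one]
  inner_eq_inner_one a b := by
    simp only [Quaternion.inner_def, star_mul, star_star, one_mul]
    simp [mul_comm]
  inner_one_mul_comm a b := by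
    simp only [Quaternion.inner_def, star_mul, one_mul]
    simp
    ring

/-! ### Eigenvalue decompositions and well-definedness of `phi` -/

section General

variable {n : ℕ} {F : Type*} [NormedDivisionRing F] [StarRing F] [InnerProductSpace ℝ F]
  [StandardInvolution F]

theorem realDiag_apply (l : Fin n → ℝ) (i j : Fin n) :
    (realDiag l : Matrix (Fin n) (Fin n) F) i j = if i = j then l i • 1 else 0 := by
  simp [realDiag, Matrix.diagonal_apply]

theorem realDiag_mulVec (l : Fin n → ℝ) (v : Fin n → F) (i : Fin n) :
    ((realDiag l : Matrix (Fin n) (Fin n) F) *ᵥ v) i = l i • v i := by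
  simp [realDiag, Matrix.mulVec_diagonal]

theorem realDiag_mul_apply (l : Fin n → ℝ) (M : Matrix (Fin n) (Fin n) F) (i j : Fin n) :
    ((realDiag l : Matrix (Fin n) (Fin n) F) * M) i j = l i • M i j := by
  simp [realDiag, Matrix.diagonal_mul]

theorem mul_realDiag_apply (l : Fin n → ℝ) (M : Matrix (Fin n) (Fin n) F) (i j : Fin n) :
    (M * (realDiag l : Matrix (Fin n) (Fin n) F)) i j = l j • M i j := by
  simp [realDiag, Matrix.mul_diagonal]

theorem star_dotProduct_self (v : Fin n → F) : star v ⬝ᵥ v = (∑ i, ‖v i‖ ^ 2) • (1 : F) := by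
  simp [dotProduct, StandardInvolution.star_mul_self', Finset.sum_smul]

theorem conjTranspose_mul_self (Q : UnitaryGp n F) : Q.1ᴴ * Q.1 = 1 := Q.2.1

theorem mul_conjTranspose_self (Q : UnitaryGp n F) : Q.1 * Q.1ᴴ = 1 := Q.2.2

theorem exists_unitary_of_orthonormal (v : Fin n → Fin n → F)
    (hv : ∀ i j, star (v i) ⬝ᵥ v j = if i = j then 1 else 0) :
    ∃ Q : UnitaryGp n F, ∀ i j, Q.1 i j = v j i := by
  have h : (Matrix.of fun i j => v j i)ᴴ * (Matrix.of fun i j => v j i) = 1 := by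
    ext i j
    rw [Matrix.mul_apply, Matrix.one_apply, ← hv i j]
    simp [dotProduct]
  -- For square matrices over a division ring, commutative or not, a one-sided inverse is two-sided.
  exact ⟨⟨_, h, mul_eq_one_comm.1 h⟩, fun i j => rfl⟩

/-- The real numbers `r` such that `X v = r v` for some `v ≠ 0`. -/
def realSpectrum (X : Matrix (Fin n) (Fin n) F) : Set ℝ :=
  {r : ℝ | ∃ v : Fin n → F, v ≠ 0 ∧ X *ᵥ v = r • v}

theorem realSpectrum_conj (Q : UnitaryGp n F) (l : Fin n → ℝ) :
    realSpectrum (Q.1 * realDiag l * Q.1ᴴ) = Set.range l := by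
  ext r
  constructor
  · rintro ⟨v, hv, h⟩
    have h1 : realDiag l *ᵥ (Q.1ᴴ *ᵥ v) = r • (Q.1ᴴ *ᵥ v) := by
      rw [← Matrix.mulVec_smul, ← h, Matrix.mulVec_mulVec, Matrix.mulVec_mulVec,
        ← Matrix.mul_assoc, ← Matrix.mul_assoc, conjTranspose_mul_self, Matrix.one_mul]
    have h2 : Q.1ᴴ *ᵥ v ≠ 0 := fun h0 => hv <| by
      rw [← Matrix.one_mulVec v, ← mul_conjTranspose_self Q, ← Matrix.mulVec_mulVec, h0,
        Matrix.mulVec_zero]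
    obtain ⟨i, hi⟩ := Function.ne_iff.1 h2
    have h3 := congrFun h1 i
    rw [realDiag_mulVec, Pi.smul_apply] at h3
    exact ⟨i, smul_left_injective ℝ hi h3⟩
  · rintro ⟨i, rfl⟩
    refine ⟨Q.1 *ᵥ Pi.single i 1, fun h0 => ?_, ?_⟩
    · have : Q.1ᴴ *ᵥ (Q.1 *ᵥ Pi.single i 1) = 0 := by rw [h0, Matrix.mulVec_zero]
      rw [Matrix.mulVec_mulVec, conjTranspose_mul_self, Matrix.one_mulVec] at this
      simpa using congrFun this i
    · rw [Matrix.mulVec_mulVec, Matrix.mul_assoc, conjTranspose_mul_self, Matrix.mul_one,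
        ← Matrix.mulVec_mulVec, ← Matrix.mulVec_smul]
      congr 1
      ext j
      rw [realDiag_mulVec, Pi.smul_apply]
      by_cases h : j = i
      · rw [h]
      · simp [h]

theorem dotProduct_eq_zero_of_eigenvectors {X : SelfAdj n F} {v w : Fin n → F} {r s : ℝ}
    [StarModule ℝ F]
    (hv : X.1 *ᵥ v = r • v) (hw : X.1 *ᵥ w = s • w) (hrs : r ≠ s) : star v ⬝ᵥ w = 0 := by
  have hX : X.1ᴴ = X.1 := X.2
  have h : star (X.1 *ᵥ v) ⬝ᵥ w = star v ⬝ᵥ X.1 *ᵥ w := by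
    rw [Matrix.star_mulVec, hX, Matrix.dotProduct_mulVec]
  rw [hv, hw, star_smul, star_trivial, smul_dotProduct, dotProduct_smul] at h
  by_contra h0
  exact hrs (smul_left_injective ℝ h0 h)

/-- Eigenvectors for distinct real eigenvalues are orthogonal, so n of them, normalised, are the
columns of a unitary matrix. No general spectral theorem is needed here, and real eigenvalues
commute with all entries even over ℍ. -/
theorem exists_eq_conj_realDiag [StarModule ℝ F] (X : SelfAdj n F) {l : Fin n → ℝ}
    (hl : Function.Injective l) (hX : ∀ i, l i ∈ realSpectrum X.1) :
    ∃ Q : UnitaryGp n F, X.1 = Q.1 * realDiag l * Q.1ᴴ := by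
  choose v hv hXv using hX
  have hpos : ∀ i, 0 < ∑ j, ‖v i j‖ ^ 2 := fun i => by
    obtain ⟨j, hj⟩ := Function.ne_iff.1 (hv i)
    exact Finset.sum_pos' (fun _ _ => by positivity)
      ⟨j, Finset.mem_univ _, pow_pos (norm_pos_iff.2 hj) 2⟩
  set c : Fin n → ℝ := fun i => (Real.sqrt (∑ j, ‖v i j‖ ^ 2))⁻¹ with hc
  obtain ⟨Q, hQ⟩ := exists_unitary_of_orthonormal (fun i => c i • v i) (fun i j => by
    rw [star_smul, star_trivial, smul_dotProduct, dotProduct_smul]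
    split_ifs with h
    · subst h
      rw [star_dotProduct_self, smul_smul, smul_smul]
      have := (hpos i).ne'
      have h2 : c i * c i * ∑ j, ‖v i j‖ ^ 2 = 1 := by
        simp only [hc]
        rw [← mul_inv, Real.mul_self_sqrt (hpos i).le, inv_mul_cancel₀ this]
      rw [h2, one_smul]
    · rw [dotProduct_eq_zero_of_eigenvectors (hXv i) (hXv j) (hl.ne h), smul_zero, smul_zero])
  refine ⟨Q, ?_⟩
  have h : X.1 * Q.1 = Q.1 * realDiag l := by
    ext i j
    rw [mul_realDiag_apply, hQ, Pi.smul_apply, smul_comm, ← Pi.smul_apply (l j), ← hXv j,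
      ← Pi.smul_apply, ← Matrix.mulVec_smul]
    simp [Matrix.mul_apply, Matrix.mulVec, dotProduct, hQ]
  rw [← h, Matrix.mul_assoc, mul_conjTranspose_self, Matrix.mul_one]

theorem exists_isOrderedEigendecomposition [StarModule ℝ F] {X : SelfAdj n F}
    (hX : X ∈ simpleSpectrum n F) : ∃ Q l, IsOrderedEigendecomposition X Q l := by
  have hcard : (realSpectrum X.1).ncard = n := hX
  -- `ncard` is also 0 for infinite sets, so finiteness can be read off only when n > 0.
  rcases Nat.eq_zero_or_pos n with rfl | hn
  · exact ⟨1, fun i => i.elim0, fun i => i.elim0, by ext i; exact i.elim0⟩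
  have hfin : (realSpectrum X.1).Finite := Set.finite_of_ncard_pos (by omega)
  have hc : hfin.toFinset.card = n := by rw [← Set.ncard_eq_toFinset_card _ hfin, hcard]
  have hl : StrictAnti fun i : Fin n => hfin.toFinset.orderEmbOfFin hc i.rev := fun i j hij =>
    (hfin.toFinset.orderEmbOfFin hc).strictMono (Fin.rev_lt_rev.2 hij)
  obtain ⟨Q, hQ⟩ := exists_eq_conj_realDiag X hl.injective fun i =>
    hfin.mem_toFinset.1 (Finset.orderEmbOfFin_mem _ hc _)
  exact ⟨Q, _, hl, hQ⟩

theorem mem_simpleSpectrum_of_injective [StarModule ℝ F] {X : SelfAdj n F} {l : Fin n → ℝ}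
    (hl : Function.Injective l) (hX : ∀ i, l i ∈ realSpectrum X.1) : X ∈ simpleSpectrum n F := by
  obtain ⟨Q, hQ⟩ := exists_eq_conj_realDiag X hl hX
  change (realSpectrum X.1).ncard = n
  rw [hQ, realSpectrum_conj, ← Set.image_univ, Set.ncard_image_of_injective _ hl]
  simp

variable {p : ℕ}

/-- The ordering forces the same Λ in both decompositions. Then QᴴQ' commutes with Λ, is therefore
diagonal, and so commutes with `Delta k a`, whose entries are real scalars. -/
theorem IsOrderedEigendecomposition.mk_eq_mk (k : Fin p → ℕ) (a : Fin (p + 1) → ℝ)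
    {X : SelfAdj n F} {Q Q' : UnitaryGp n F} {l l' : Fin n → ℝ}
    (h : IsOrderedEigendecomposition X Q l) (h' : IsOrderedEigendecomposition X Q' l') :
    Flag.mk k a Q = Flag.mk k a Q' := by
  obtain ⟨hl, hX⟩ := h
  obtain ⟨hl', hX'⟩ := h'
  have hrange : Set.range l = Set.range l' := by
    rw [← realSpectrum_conj Q l, ← realSpectrum_conj Q' l', ← hX, ← hX']
  have hll : l = l' := by
    have := StrictMono.range_inj (f := fun i : Fin n => -l i) (g := fun i => -l' i)
      (fun i j hij => neg_lt_neg (hl hij)) (fun i j hij => neg_lt_neg (hl' hij))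
    rw [Set.range_comp' Neg.neg l, Set.range_comp' Neg.neg l', hrange] at this
    funext i
    exact neg_injective (congrFun (this.1 rfl) i)
  subst hll
  have hcomm : realDiag l * (Q.1ᴴ * Q'.1) = (Q.1ᴴ * Q'.1) * realDiag l := by
    have h1 : Q.1ᴴ * (Q.1 * realDiag l * Q.1ᴴ) * Q'.1 = Q.1ᴴ * (Q'.1 * realDiag l * Q'.1ᴴ) * Q'.1 := by
      rw [← hX, ← hX']
    simp only [Matrix.mul_assoc, conjTranspose_mul_self, Matrix.mul_one] at h1
    simpa only [← Matrix.mul_assoc, conjTranspose_mul_self, Matrix.one_mul] using h1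
  have hdiag : ∀ i j, i ≠ j → (Q.1ᴴ * Q'.1) i j = 0 := fun i j hij => by
    have := congrFun (congrFun hcomm i) j
    rw [realDiag_mul_apply, mul_realDiag_apply] at this
    by_contra h0
    exact hl.injective.ne hij (smul_left_injective ℝ h0 this)
  have hD : Delta k a * (Q.1ᴴ * Q'.1) = (Q.1ᴴ * Q'.1) * Delta k a := by
    ext i j
    rw [Delta, realDiag_mul_apply, mul_realDiag_apply]
    by_cases hij : i = j
    · rw [hij]
    · rw [hdiag i j hij, smul_zero, smul_zero]
  apply Subtype.ext
  change Q.1 * Delta k a * Q.1ᴴ = Q'.1 * Delta k a * Q'.1ᴴ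
  calc Q.1 * Delta k a * Q.1ᴴ = Q.1 * (Delta k a * (Q.1ᴴ * Q'.1)) * Q'.1ᴴ := by
        simp only [Matrix.mul_assoc, mul_conjTranspose_self, Matrix.mul_one]
    _ = Q'.1 * Delta k a * Q'.1ᴴ := by
        rw [hD]
        simp only [← Matrix.mul_assoc, mul_conjTranspose_self, Matrix.one_mul]

theorem IsOrderedEigendecomposition.phi_eq (k : Fin p → ℕ) (a : Fin (p + 1) → ℝ)
    {X : SelfAdj n F} {Q : UnitaryGp n F} {l : Fin n → ℝ}
    (h : IsOrderedEigendecomposition X Q l) : phi k a X = Flag.mk k a Q := by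
  have hex : ∃ Q : UnitaryGp n F, ∃ l : Fin n → ℝ, IsOrderedEigendecomposition X Q l := ⟨Q, l, h⟩
  rw [phi, dif_pos hex]
  exact hex.choose_spec.choose_spec.mk_eq_mk k a h

end General

/-! ### A determinant criterion for simple spectrum -/

section General

variable {n : ℕ} {F : Type*} [NormedDivisionRing F] [StarRing F] [InnerProductSpace ℝ F]
  [StandardInvolution F]

theorem inner_mul_left (a b c : F) : inner ℝ (a * b) c = inner ℝ b (star a * c) := by
  rw [StandardInvolution.inner_eq_inner_one, StandardInvolution.inner_eq_inner_one b, star_mul,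
    mul_assoc]

/-- The real part of the trace, as a real linear map. -/
noncomputable def reTrace : Matrix (Fin n) (Fin n) F →ₗ[ℝ] ℝ :=
  (innerₛₗ ℝ (1 : F)) ∘ₗ Matrix.traceLinearMap (Fin n) ℝ F

theorem reTrace_apply (M : Matrix (Fin n) (Fin n) F) : reTrace M = inner ℝ (1 : F) M.trace := rfl

/-- Over ℍ the trace itself is not cyclic; its real part is, because Re(ab) = Re(ba). -/
theorem reTrace_mul_comm (M N : Matrix (Fin n) (Fin n) F) : reTrace (M * N) = reTrace (N * M) := by
  simp only [reTrace_apply, Matrix.trace, Matrix.diag, Matrix.mul_apply, inner_sum]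
  rw [Finset.sum_comm]
  simp_rw [StandardInvolution.inner_one_mul_comm (M _ _)]

theorem continuous_reTrace : Continuous (reTrace : Matrix (Fin n) (Fin n) F →ₗ[ℝ] ℝ) :=
  (innerSL ℝ (1 : F)).continuous.comp continuous_id.matrix_trace

/-- Left multiplication by a matrix on the real inner product space `Fⁿ`. -/
noncomputable def mulVecReal (X : Matrix (Fin n) (Fin n) F) :
    Module.End ℝ (PiLp 2 fun _ : Fin n => F) where
  toFun v := WithLp.toLp 2 (X *ᵥ v.ofLp)
  map_add' v w := by simp [Matrix.mulVec_add]
  map_smul' r v := by simp [Matrix.mulVec_smul]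

theorem mulVecReal_pow_apply (X : Matrix (Fin n) (Fin n) F) (m : ℕ)
    (v : PiLp 2 fun _ : Fin n => F) :
    (mulVecReal X ^ m) v = WithLp.toLp 2 ((X ^ m) *ᵥ v.ofLp) := by
  induction m with
  | zero => simp
  | succ m ih =>
    rw [pow_succ', Module.End.mul_apply, ih, pow_succ', ← Matrix.mulVec_mulVec]
    rfl

theorem isSymmetric_mulVecReal (X : SelfAdj n F) : (mulVecReal X.1).IsSymmetric := by
  intro v w
  have hX : ∀ i j, star (X.1 i j) = X.1 j i := fun i j => congrFun (congrFun X.2 j) i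
  simp only [PiLp.inner_apply, mulVecReal, LinearMap.coe_mk, AddHom.coe_mk, Matrix.mulVec,
    dotProduct, sum_inner, inner_sum]
  rw [Finset.sum_comm]
  simp_rw [inner_mul_left, hX]

theorem mem_realSpectrum_of_hasEigenvalue {X : Matrix (Fin n) (Fin n) F} {r : ℝ}
    (h : Module.End.HasEigenvalue (mulVecReal X) r) : r ∈ realSpectrum X := by
  obtain ⟨v, hv⟩ := h.exists_hasEigenvector
  refine ⟨v.ofLp, fun h0 => hv.2 ?_, ?_⟩
  · ext i
    exact congrFun h0 i
  · exact congrArg WithLp.ofLp hv.apply_eq_smul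

/-- As a symmetric operator on the real inner product space Fⁿ, X is diagonalisable, so the product
of X - r over its distinct real eigenvalues kills every eigenspace and hence X itself. -/
theorem sum_coeff_smul_pow_eq_zero [FiniteDimensional ℝ F] (X : SelfAdj n F)
    (h : (realSpectrum X.1).Finite) :
    ∑ i ∈ Finset.range (h.toFinset.card + 1),
      (∏ r ∈ h.toFinset, (Polynomial.X - Polynomial.C r)).coeff i • X.1 ^ i = 0 := by
  set q : Polynomial ℝ := ∏ r ∈ h.toFinset, (Polynomial.X - Polynomial.C r) with hq
  have hdeg : q.natDegree = h.toFinset.card := by simp [hq]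
  have hT := isSymmetric_mulVecReal X
  have htop : LinearMap.ker (Polynomial.aeval (mulVecReal X.1) q) = ⊤ := by
    rw [eq_top_iff, ← Submodule.orthogonal_eq_bot_iff.1 hT.orthogonalComplement_iSup_eigenspaces_eq_bot]
    refine iSup_le fun μ v hv => ?_
    rw [LinearMap.mem_ker]
    by_cases h0 : v = 0
    · rw [h0, map_zero]
    · have hv' : Module.End.HasEigenvector (mulVecReal X.1) μ v := ⟨hv, h0⟩
      rw [Module.End.aeval_apply_of_hasEigenvector hv']
      have hμ : μ ∈ h.toFinset := h.mem_toFinset.2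
        (mem_realSpectrum_of_hasEigenvalue (Module.End.hasEigenvalue_of_hasEigenvector hv'))
      rw [hq, Polynomial.eval_prod, Finset.prod_eq_zero hμ (by simp), zero_smul]
  have hv : ∀ v : Fin n → F,
      (∑ i ∈ Finset.range (h.toFinset.card + 1), q.coeff i • X.1 ^ i) *ᵥ v = 0 := fun v => by
    have h1 : Polynomial.aeval (mulVecReal X.1) q (WithLp.toLp 2 v) = 0 := by
      rw [← LinearMap.mem_ker, htop]; trivial
    rw [Polynomial.aeval_eq_sum_range, hdeg, LinearMap.sum_apply] at h1
    simp only [LinearMap.smul_apply, mulVecReal_pow_apply] at h1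
    have h2 := congrArg WithLp.ofLp h1
    rw [WithLp.ofLp_sum] at h2
    rw [Matrix.sum_mulVec]
    simp_rw [Matrix.smul_mulVec]
    exact h2
  ext i j
  simpa using congrFun (hv (Pi.single j 1)) i

/-- The Gram matrix `(Re tr X^{i+j})` of the powers `1, X, …, X^{n-1}`. -/
noncomputable def powerGram (X : Matrix (Fin n) (Fin n) F) : Matrix (Fin n) (Fin n) ℝ :=
  Matrix.of fun i j => reTrace (X ^ (i.1 + j.1))

theorem continuous_det_powerGram [ContinuousMul F] :
    Continuous fun X : Matrix (Fin n) (Fin n) F => (powerGram X).det := by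
  refine Continuous.matrix_det (continuous_matrix fun i j => ?_)
  exact continuous_reTrace.comp (continuous_pow _)

/-- With fewer than n eigenvalues, a monic polynomial of degree below n annihilates X. Its
coefficients give a linear relation among 1, X, …, X^{n-1}, which makes the Gram matrix singular. -/
theorem mem_simpleSpectrum_of_det_powerGram_ne_zero [FiniteDimensional ℝ F] [StarModule ℝ F]
    {X : SelfAdj n F} (hX : (powerGram X.1).det ≠ 0) : X ∈ simpleSpectrum n F := by
  -- Finding n eigenvalues is enough: they diagonalise X, so there are no others.
  have key : ∃ s : Finset ℝ, ↑s ⊆ realSpectrum X.1 ∧ s.card = n := by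
    by_cases hfin : (realSpectrum X.1).Finite
    · by_cases hcard : n ≤ hfin.toFinset.card
      · obtain ⟨s, hs, hsn⟩ := Finset.exists_subset_card_eq hcard
        exact ⟨s, fun x hx => hfin.mem_toFinset.1 (hs hx), hsn⟩
      · exfalso
        apply hX
        set q : Polynomial ℝ := ∏ r ∈ hfin.toFinset, (Polynomial.X - Polynomial.C r) with hq
        have h0 : ∑ i ∈ Finset.range n, q.coeff i • X.1 ^ i = 0 := by
          rw [← sum_coeff_smul_pow_eq_zero X hfin]
          symm
          refine Finset.sum_subset (Finset.range_subset_range.2 (by omega)) fun i _ hi => ?_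
          rw [Polynomial.coeff_eq_zero_of_natDegree_lt, zero_smul]
          simp only [Finset.mem_range] at hi
          simp only [Polynomial.natDegree_finsetProd_X_sub_C_eq_card]
          omega
        rw [← Matrix.exists_mulVec_eq_zero_iff]
        refine ⟨fun i => q.coeff i, fun h => ?_, ?_⟩
        -- The kernel vector is nonzero because its entry at the degree is the leading coefficient
        -- 1.
        · have h1 := congrFun h ⟨hfin.toFinset.card, by omega⟩
          have h2 : q.Monic := Polynomial.monic_prod_of_monic _ _ fun r _ =>
            Polynomial.monic_X_sub_C r
          have h3 : q.coeff hfin.toFinset.card = 1 := by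
            rw [← h2.coeff_natDegree, hq, Polynomial.natDegree_finsetProd_X_sub_C_eq_card]
          simp only [Pi.zero_apply] at h1
          rw [h3] at h1
          exact one_ne_zero h1
        · ext i
          have h1 := congrArg (fun M => reTrace (X.1 ^ i.1 * M)) h0
          simp only [Finset.mul_sum, map_sum, Matrix.mul_smul, map_smul, ← pow_add, mul_zero,
            map_zero] at h1
          rw [Finset.sum_range] at h1
          simpa [Matrix.mulVec, dotProduct, powerGram, mul_comm] using h1
    · exact Set.Infinite.exists_subset_card_eq hfin n
  obtain ⟨s, hs, hsn⟩ := key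
  exact mem_simpleSpectrum_of_injective (s.orderEmbOfFin hsn).injective fun i =>
    hs (s.orderEmbOfFin_mem hsn i)

theorem realDiag_pow (l : Fin n → ℝ) (m : ℕ) :
    (realDiag l : Matrix (Fin n) (Fin n) F) ^ m = realDiag fun i => l i ^ m := by
  rw [realDiag, Matrix.diagonal_pow, realDiag]
  congr 1
  ext i
  simp [smul_pow]

theorem det_powerGram_realDiag_ne_zero {l : Fin n → ℝ} (hl : Function.Injective l) :
    (powerGram (realDiag l : Matrix (Fin n) (Fin n) F)).det ≠ 0 := by
  have h : powerGram (realDiag l : Matrix (Fin n) (Fin n) F) =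
      (Matrix.vandermonde l)ᵀ * Matrix.vandermonde l := by
    ext i j
    rw [powerGram, Matrix.of_apply, realDiag_pow, reTrace_apply, realDiag, Matrix.trace_diagonal,
      inner_sum, Matrix.mul_apply]
    simp [inner_smul_right, Matrix.vandermonde_apply, pow_add]
  rw [h, Matrix.det_mul, Matrix.det_transpose]
  exact mul_ne_zero (Matrix.det_vandermonde_ne_zero_iff.2 hl)
    (Matrix.det_vandermonde_ne_zero_iff.2 hl)

theorem det_powerGram_smul (t : ℝ) (X : Matrix (Fin n) (Fin n) F) :
    (powerGram (t • X)).det =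
      (∏ i : Fin n, t ^ i.1) * ((∏ i : Fin n, t ^ i.1) * (powerGram X).det) := by
  rw [← Matrix.det_mul_row, ← Matrix.det_mul_column]
  congr 1
  ext i j
  simp only [powerGram, Matrix.of_apply, smul_pow, map_smul, smul_eq_mul]
  ring

/-- A and B need not commute, so the coefficients are built by recursion rather than by the binomial
formula. What matters is that they do not depend on t. -/
theorem exists_add_smul_pow_eq_sum (A B : Matrix (Fin n) (Fin n) F) (m : ℕ) :
    ∃ C : ℕ → Matrix (Fin n) (Fin n) F, ∀ t : ℝ,
      (A + t • B) ^ m = ∑ i ∈ Finset.range (m + 1), t ^ i • C i := by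
  induction m with
  | zero => exact ⟨fun _ => 1, fun t => by simp⟩
  | succ m ih =>
    obtain ⟨C, hC⟩ := ih
    refine ⟨fun i => (if i < m + 1 then C i * A else 0) + (if i = 0 then 0 else C (i - 1) * B),
      fun t => ?_⟩
    simp only [smul_add, Finset.sum_add_distrib]
    rw [pow_succ, hC, mul_add, Finset.sum_mul, Finset.sum_mul, Finset.sum_range_succ _ (m + 1),
      Finset.sum_range_succ' _ (m + 1)]
    congr 1
    · simp only [lt_irrefl, if_false, smul_zero, add_zero]
      refine Finset.sum_congr rfl fun i hi => ?_
      rw [if_pos (Finset.mem_range.1 hi), Matrix.smul_mul]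
    · simp only [pow_succ, mul_smul, Nat.succ_ne_zero, if_false, if_true, smul_zero, add_zero,
        Nat.add_sub_cancel, Matrix.smul_mul, Matrix.mul_smul]
      exact Finset.sum_congr rfl fun i _ => smul_comm _ _ _

theorem exists_polynomial_det_powerGram (A B : Matrix (Fin n) (Fin n) F) :
    ∃ P : Polynomial ℝ, ∀ t : ℝ, P.eval t = (powerGram (A + t • B)).det := by
  choose C hC using exists_add_smul_pow_eq_sum A B
  refine ⟨(Matrix.of fun i j : Fin n => ∑ k ∈ Finset.range (i.1 + j.1 + 1),
    Polynomial.C (reTrace (C (i.1 + j.1) k)) * Polynomial.X ^ k).det, fun t => ?_⟩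
  rw [← Polynomial.coe_evalRingHom, RingHom.map_det]
  congr 1
  ext i j
  simp only [powerGram, hC, RingHom.mapMatrix_apply, Matrix.map_apply, Matrix.of_apply, map_sum,
    Polynomial.coe_evalRingHom, Polynomial.eval_finsetSum, Polynomial.eval_mul, Polynomial.eval_C,
    Polynomial.eval_pow, Polynomial.eval_X, map_smul, smul_eq_mul]
  simp_rw [mul_comm]

/-- Write A + tD = t(D + t⁻¹A) for t ≠ 0. By homogeneity the determinant is a power of t times a
polynomial in t⁻¹, and that polynomial is not zero because its value at 0 is the squared Vandermonde
determinant of `l`. -/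
theorem finite_det_powerGram_add_smul_eq_zero {l : Fin n → ℝ} (hl : Function.Injective l)
    (A : Matrix (Fin n) (Fin n) F) :
    {t : ℝ | (powerGram (A + t • realDiag l)).det = 0}.Finite := by
  obtain ⟨P, hP⟩ := exists_polynomial_det_powerGram (realDiag l) A
  have hP0 : P ≠ 0 := by
    rintro rfl
    refine det_powerGram_realDiag_ne_zero (F := F) hl ?_
    simpa using (hP 0).symm
  have hfin : {s : ℝ | P.IsRoot s}.Finite := Polynomial.finite_setOfPred_isRoot hP0
  refine ((hfin.preimage (inv_injective.injOn)).insert 0).subset fun t ht => ?_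
  by_cases h0 : t = 0
  · exact Or.inl h0
  · right
    change P.eval t⁻¹ = 0
    rw [hP]
    have h1 : A + t • realDiag l = t • (realDiag l + t⁻¹ • A) := by
      rw [smul_add, smul_inv_smul₀ h0, add_comm]
    have h2 : ∏ i : Fin n, t ^ i.1 ≠ 0 := Finset.prod_ne_zero_iff.2 fun i _ => pow_ne_zero _ h0
    rw [Set.mem_ofPred_eq, h1, det_powerGram_smul] at ht
    simpa [h2] using ht

end General

/-! ### Topology, real coordinates, and almost sure simplicity of the spectrum -/

section General

variable {n : ℕ} {F : Type*} [NormedDivisionRing F] [StarRing F] [InnerProductSpace ℝ F]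
  [StandardInvolution F]

theorem norm_star_eq (a : F) : ‖star a‖ = ‖a‖ := by
  by_cases h : a = 0
  · simp [h]
  · have h1 := congrArg norm (StandardInvolution.star_mul_self' a)
    rw [norm_mul, norm_smul, norm_one, mul_one, Real.norm_of_nonneg (by positivity), sq] at h1
    exact mul_right_cancel₀ (norm_ne_zero_iff.2 h) h1

instance : ContinuousStar F :=
  ⟨(AddMonoidHomClass.isometry_of_norm (starAddEquiv : F ≃+ F) norm_star_eq).continuous⟩

theorem norm_apply_le_one (Q : UnitaryGp n F) (i j : Fin n) : ‖Q.1 i j‖ ≤ 1 := by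
  have h := congrFun (congrFun (conjTranspose_mul_self Q) j) j
  have h1 : (Q.1ᴴ * Q.1) j j = star (fun i => Q.1 i j) ⬝ᵥ (fun i => Q.1 i j) := rfl
  rw [h1, star_dotProduct_self, Matrix.one_apply_eq] at h
  have h2 := congrArg norm h
  rw [norm_smul, norm_one, mul_one,
    Real.norm_of_nonneg (Finset.sum_nonneg fun _ _ => by positivity)] at h2
  have h3 : ‖Q.1 i j‖ ^ 2 ≤ 1 := h2 ▸
    Finset.single_le_sum (f := fun i => ‖Q.1 i j‖ ^ 2) (fun _ _ => by positivity)
      (Finset.mem_univ i)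
  exact (sq_le_one_iff₀ (norm_nonneg _)).1 h3

theorem isClosed_unitary : IsClosed (unitary (Matrix (Fin n) (Fin n) F) : Set (Matrix (Fin n) (Fin n) F)) := by
  have : (unitary (Matrix (Fin n) (Fin n) F) : Set (Matrix (Fin n) (Fin n) F)) =
      {Q | Qᴴ * Q = 1} ∩ {Q | Q * Qᴴ = 1} := rfl
  rw [this]
  exact (isClosed_eq (by fun_prop) continuous_const).inter
    (isClosed_eq (by fun_prop) continuous_const)

instance [FiniteDimensional ℝ F] : CompactSpace (UnitaryGp n F) := by
  have : ProperSpace F := FiniteDimensional.proper ℝ F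
  have hK : IsCompact {M : Matrix (Fin n) (Fin n) F | ∀ i j, M i j ∈ Metric.closedBall (0 : F) 1} :=
    (isCompact_pi_infinite (X := fun _ : Fin n => Fin n → F) fun _ =>
      isCompact_pi_infinite (X := fun _ : Fin n => F) fun _ => isCompact_closedBall 0 1)
  refine isCompact_iff_compactSpace.1 (hK.of_isClosed_subset isClosed_unitary ?_)
  intro Q hQ i j
  rw [mem_closedBall_zero_iff]
  exact norm_apply_le_one ⟨Q, hQ⟩ i j

instance [FiniteDimensional ℝ F] : SecondCountableTopology (Matrix (Fin n) (Fin n) F) := by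
  have : ProperSpace F := FiniteDimensional.proper ℝ F
  exact inferInstanceAs (SecondCountableTopology (Fin n → Fin n → F))

variable [StarModule ℝ F]

theorem inner_one_smul_one (r : ℝ) : inner ℝ (1 : F) (r • (1 : F)) = r := by
  simp [inner_smul_right]

/-- Both `star a * a` and `star (1 + a) * (1 + a)` are real multiples of 1, and for self-adjoint a
expanding the latter isolates 2a. -/
theorem eq_smul_one_of_star_eq {a : F} (ha : star a = a) : a = (inner ℝ (1 : F) a) • (1 : F) := by
  by_cases h : a = 0
  · simp [h]
  have h2 : star (1 + a) * (1 + a) = 1 + (2 : ℝ) • a + star a * a := by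
    rw [star_add, star_one, ha, two_smul]
    noncomm_ring
  rw [StandardInvolution.star_mul_self', StandardInvolution.star_mul_self'] at h2
  have h3 : a = ((‖1 + a‖ ^ 2 - 1 - ‖a‖ ^ 2) / 2) • (1 : F) := by
    have : (2 : ℝ) • a = (‖1 + a‖ ^ 2 - 1 - ‖a‖ ^ 2) • (1 : F) := by
      rw [sub_smul, sub_smul, h2, one_smul]
      abel
    rw [div_eq_inv_mul, mul_smul, ← this, inv_smul_smul₀ two_ne_zero]
  conv_rhs => rw [h3, inner_one_smul_one]
  exact h3

/-- The parametrization of the self-adjoint matrices by their diagonal and upper triangular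
entries, as a linear equivalence. -/
noncomputable def coordsEquiv :
    ((Fin n → ℝ) × ({q : Fin n × Fin n // q.1 < q.2} → F)) ≃ₗ[ℝ] SelfAdj n F where
  toFun := ofCoords
  map_add' c c' := by
    ext i j
    rcases lt_trichotomy i j with h | rfl | h
    · simp [ofCoords, h]
    · simp [ofCoords, add_smul]
    · simp [ofCoords, h, h.not_gt]
  map_smul' r c := by
    ext i j
    rcases lt_trichotomy i j with h | rfl | h
    · simp [ofCoords, h]
    · simp [ofCoords, mul_smul]
    · simp [ofCoords, h, h.not_gt]
  invFun X := (fun i => inner ℝ (1 : F) (X.1 i i), fun q => X.1 q.1.1 q.1.2)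
  left_inv c := by
    ext i
    · simp [ofCoords, inner_one_smul_one]
    · simp [ofCoords, i.2]
  right_inv X := by
    have hX : ∀ i j, star (X.1 i j) = X.1 j i := fun i j => congrFun (congrFun X.2 j) i
    ext i j
    rcases lt_trichotomy i j with h | rfl | h
    · simp [ofCoords, h]
    · simp [ofCoords, ← eq_smul_one_of_star_eq (hX i i)]
    · simp [ofCoords, h, h.not_gt, hX]

theorem continuous_coordsEquiv : Continuous (coordsEquiv (n := n) (F := F)) := by
  refine Continuous.subtype_mk (continuous_matrix fun i j => ?_) _
  rcases lt_trichotomy i j with h | rfl | h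
  · simp only [Matrix.of_apply, h, dif_pos]
    fun_prop
  · simp only [Matrix.of_apply, lt_irrefl, dif_neg, not_false_eq_true]
    fun_prop
  · simp only [Matrix.of_apply, h, h.not_gt, dif_pos, dif_neg, not_false_eq_true]
    fun_prop

theorem continuous_coordsEquiv_symm : Continuous (coordsEquiv (n := n) (F := F)).symm := by
  have h : ∀ i j, Continuous fun X : SelfAdj n F => X.1 i j := fun i j =>
    continuous_subtype_val.matrix_elem i j
  exact Continuous.prodMk (continuous_pi fun i => continuous_const.inner (h i i))
    (continuous_pi fun q => h _ _)

variable [FiniteDimensional ℝ F] [MeasurableSpace F] [BorelSpace F]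

instance : (volume : Measure
    ((Fin n → ℝ) × ({q : Fin n × Fin n // q.1 < q.2} → F))).IsAddHaarMeasure :=
  have : ProperSpace F := FiniteDimensional.proper ℝ F
  Measure.prod.instIsAddHaarMeasure _ _

instance : (lebesgue n F).IsAddHaarMeasure :=
  have : ProperSpace F := FiniteDimensional.proper ℝ F
  AddEquiv.isAddHaarMeasure_map (volume : Measure
    ((Fin n → ℝ) × ({q : Fin n × Fin n // q.1 < q.2} → F)))
    (coordsEquiv (n := n) (F := F)).toAddEquiv continuous_coordsEquiv continuous_coordsEquiv_symm

/-- Fubini along the lines in direction diag(0, 1, …, n-1): each of them meets the zero set of the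
determinant in a finite set. The determinant condition is open, so the measurability of
`simpleSpectrum` is never needed. -/
theorem ae_lebesgue_mem_simpleSpectrum : ∀ᵐ X ∂(lebesgue n F), X ∈ simpleSpectrum n F := by
  have : ProperSpace F := FiniteDimensional.proper ℝ F
  have hcont : Continuous fun X : SelfAdj n F => (powerGram X.1).det :=
    continuous_det_powerGram.comp continuous_subtype_val
  have hopen : IsOpen {X : SelfAdj n F | (powerGram X.1).det ≠ 0} :=
    isOpen_ne_fun hcont continuous_const
  suffices h : ∀ᵐ X ∂(lebesgue n F), X ∈ {X : SelfAdj n F | (powerGram X.1).det ≠ 0} from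
    h.mono fun X hX => mem_simpleSpectrum_of_det_powerGram_ne_zero hX
  change ∀ᵐ X ∂(Measure.map (coordsEquiv (n := n) (F := F)) volume), _
  refine (ae_map_iff continuous_coordsEquiv.measurable.aemeasurable hopen.measurableSet).2 ?_
  have hl : Function.Injective fun i : Fin n => (i.1 : ℝ) := fun i j h =>
    Fin.ext (Nat.cast_injective h)
  refine ae_mem_of_ae_add_linearMap_mem (𝕜 := ℝ) (E := ℝ)
    (LinearMap.toSpanSingleton ℝ ((Fin n → ℝ) × ({q : Fin n × Fin n // q.1 < q.2} → F))
      (fun i => (i.1 : ℝ), 0)) volume volume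
    (s := coordsEquiv (n := n) (F := F) ⁻¹' {X : SelfAdj n F | (powerGram X.1).det ≠ 0})
    (continuous_coordsEquiv.measurable hopen.measurableSet) fun c => ?_
  have hfin := finite_det_powerGram_add_smul_eq_zero hl (coordsEquiv (n := n) (F := F) c).1
  filter_upwards [hfin.countable.ae_notMem volume] with t ht h0
  apply ht
  have hD : (coordsEquiv (n := n) (F := F) (fun i => (i.1 : ℝ), 0)).1 =
      realDiag fun i => (i.1 : ℝ) := by
    ext i j
    rw [realDiag_apply]
    rcases lt_trichotomy i j with h | rfl | h
    · simp [coordsEquiv, ofCoords, h, h.ne]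
    · simp [coordsEquiv, ofCoords]
    · simp [coordsEquiv, ofCoords, h, h.not_gt, h.ne']
  rw [LinearMap.toSpanSingleton_apply, map_add, map_smul] at h0
  change (powerGram ((coordsEquiv (n := n) (F := F) c).1 +
    t • (coordsEquiv (n := n) (F := F) (fun i => (i.1 : ℝ), 0)).1)).det = 0 at h0
  rwa [hD] at h0

theorem ae_gaussianEnsemble_mem_simpleSpectrum :
    ∀ᵐ X ∂(gaussianEnsemble n F), X ∈ simpleSpectrum n F :=
  (withDensity_absolutelyContinuous _ _).ae_le ae_lebesgue_mem_simpleSpectrum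

end General

/-! ### Group actions, invariant measures and the law of `phi` -/

section General

variable {n : ℕ} {F : Type*} [NormedDivisionRing F] [StarRing F] [InnerProductSpace ℝ F]
  [StandardInvolution F]

/-- The action `X ↦ A X Aᴴ` of the group on the self-adjoint matrices. -/
def conjSelfAdj (A : UnitaryGp n F) (X : SelfAdj n F) : SelfAdj n F :=
  ⟨A.1 * X.1 * A.1ᴴ, by
    have hX : X.1ᴴ = X.1 := X.2
    rw [selfAdjoint.mem_iff, Matrix.star_eq_conjTranspose]
    simp only [Matrix.conjTranspose_mul, Matrix.conjTranspose_conjTranspose, hX, Matrix.mul_assoc]⟩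

theorem conjSelfAdj_mul (A B : UnitaryGp n F) (X : SelfAdj n F) :
    conjSelfAdj (A * B) X = conjSelfAdj A (conjSelfAdj B X) :=
  Subtype.ext <| by
    simp only [conjSelfAdj, Submonoid.coe_mul, Matrix.conjTranspose_mul, Matrix.mul_assoc]

theorem conjSelfAdj_one (X : SelfAdj n F) : conjSelfAdj 1 X = X :=
  Subtype.ext <| by simp [conjSelfAdj]

/-- `X ↦ A X Aᴴ` as an additive equivalence. -/
def conjAddEquiv (A : UnitaryGp n F) : SelfAdj n F ≃+ SelfAdj n F where
  toFun := conjSelfAdj A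
  invFun := conjSelfAdj A⁻¹
  left_inv X := by rw [← conjSelfAdj_mul, inv_mul_cancel, conjSelfAdj_one]
  right_inv X := by rw [← conjSelfAdj_mul, mul_inv_cancel, conjSelfAdj_one]
  map_add' X Y := Subtype.ext <| by simp [conjSelfAdj, Matrix.mul_add, Matrix.add_mul]

theorem continuous_conjSelfAdj_uncurry :
    Continuous fun q : UnitaryGp n F × SelfAdj n F => conjSelfAdj q.1 q.2 :=
  Continuous.subtype_mk (by fun_prop) _

theorem continuous_conjSelfAdj (A : UnitaryGp n F) : Continuous (conjSelfAdj A) :=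
  continuous_conjSelfAdj_uncurry.comp (Continuous.prodMk_right A)

theorem IsOrderedEigendecomposition.conj {X : SelfAdj n F} {Q : UnitaryGp n F} {l : Fin n → ℝ}
    (h : IsOrderedEigendecomposition X Q l) (A : UnitaryGp n F) :
    IsOrderedEigendecomposition (conjSelfAdj A X) (A * Q) l := by
  refine ⟨h.1, ?_⟩
  simp only [conjSelfAdj, h.2, Submonoid.coe_mul, Matrix.conjTranspose_mul, Matrix.mul_assoc]

variable {p : ℕ} {k : Fin p → ℕ} {a : Fin (p + 1) → ℝ}

theorem Flag.conj_mk (A Q : UnitaryGp n F) : Flag.conj A (Flag.mk k a Q) = Flag.mk k a (A * Q) :=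
  Subtype.ext <| by
    simp only [Flag.conj, Flag.mk, Submonoid.coe_mul, Matrix.conjTranspose_mul, Matrix.mul_assoc]

theorem Flag.exists_eq_mk (Y : Flag n F k a) : ∃ Q, Y = Flag.mk k a Q := by
  obtain ⟨Q, hQ⟩ := Y.2
  exact ⟨Q, Subtype.ext hQ.symm⟩

theorem Flag.continuous_mk : Continuous (Flag.mk (n := n) (F := F) k a) :=
  Continuous.subtype_mk (by fun_prop) _

theorem Flag.continuous_conj_uncurry :
    Continuous fun q : UnitaryGp n F × Flag n F k a => Flag.conj q.1 q.2 :=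
  Continuous.subtype_mk (by fun_prop) _

theorem Flag.continuous_conj (A : UnitaryGp n F) :
    Continuous (Flag.conj A : Flag n F k a → Flag n F k a) :=
  Flag.continuous_conj_uncurry.comp (Continuous.prodMk_right A)

theorem IsOrderedEigendecomposition.phi_conj {X : SelfAdj n F} {Q : UnitaryGp n F} {l : Fin n → ℝ}
    (h : IsOrderedEigendecomposition X Q l) (A : UnitaryGp n F) :
    phi k a (conjSelfAdj A X) = Flag.conj A (phi k a X) := by
  rw [(h.conj A).phi_eq, h.phi_eq, Flag.conj_mk]

variable [FiniteDimensional ℝ F]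

theorem Flag.measurable_conj (A : UnitaryGp n F) :
    Measurable (Flag.conj A : Flag n F k a → Flag n F k a) :=
  (Flag.continuous_conj A).measurable

/-- Compute the ρ × ν measure of {(A, Y) : AYAᴴ ∈ s} in both orders. For fixed A, invariance of ν
gives ν(s). For fixed Y, transitivity and right invariance of ρ give a value independent of Y. -/
theorem IsInvariantDistribution.eq_map {ν : Measure (Flag n F k a)}
    (hν : IsInvariantDistribution ν) (ρ : Measure (UnitaryGp n F)) [IsProbabilityMeasure ρ]
    [ρ.IsMulRightInvariant] : ν = ρ.map (Flag.mk k a) := by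
  have := hν.1
  ext s hs
  have hS : MeasurableSet {q : UnitaryGp n F × Flag n F k a | Flag.conj q.1 q.2 ∈ s} :=
    Flag.continuous_conj_uncurry.measurable hs
  have h1 : (ρ.prod ν) {q | Flag.conj q.1 q.2 ∈ s} = ν s := by
    rw [Measure.prod_apply hS]
    have (A : UnitaryGp n F) :
        ν (Prod.mk A ⁻¹' {q : UnitaryGp n F × Flag n F k a | Flag.conj q.1 q.2 ∈ s}) = ν s := by
      conv_rhs => rw [← hν.2 A, Measure.map_apply (Flag.measurable_conj A) hs]
      rfl
    simp_rw [this]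
    simp
  have h2 : (ρ.prod ν) {q | Flag.conj q.1 q.2 ∈ s} = ρ.map (Flag.mk k a) s := by
    rw [Measure.prod_apply_symm hS]
    have (Y : Flag n F k a) :
        ρ ((fun A => (A, Y)) ⁻¹' {q : UnitaryGp n F × Flag n F k a | Flag.conj q.1 q.2 ∈ s}) =
          ρ.map (Flag.mk k a) s := by
      obtain ⟨Q, rfl⟩ := Flag.exists_eq_mk Y
      conv_rhs => rw [Measure.map_apply Flag.continuous_mk.measurable hs,
        ← map_mul_right_eq_self ρ Q,
        Measure.map_apply (measurable_mul_const Q) (Flag.continuous_mk.measurable hs)]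
      simp only [Set.preimage_ofPred_eq, Flag.conj_mk]
      rfl
    simp_rw [this]
    simp
  rw [← h1, h2]

theorem exists_isUniformDistribution (k : Fin p → ℕ) (a : Fin (p + 1) → ℝ) :
    ∃ ν : Measure (Flag n F k a), IsUniformDistribution ν := by
  let μ : Measure (UnitaryGp n F) := Measure.haarMeasure ⊤
  have hμ : IsProbabilityMeasure μ := ⟨Measure.haarMeasure_self⟩
  -- Left invariance of μ yields existence, and right invariance of `μ.inv` yields uniqueness, so
  -- unimodularity of the group is not needed.
  have hinv : IsProbabilityMeasure μ.inv := ⟨by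
    rw [Measure.inv_apply, Set.inv_univ, measure_univ]⟩
  have hν : IsInvariantDistribution (μ.map (Flag.mk k a)) := by
    refine ⟨Measure.isProbabilityMeasure_map Flag.continuous_mk.measurable.aemeasurable,
      fun A => ?_⟩
    rw [Measure.map_map (Flag.measurable_conj A) Flag.continuous_mk.measurable]
    have : Flag.conj A ∘ Flag.mk k a = Flag.mk k a ∘ fun Q => A * Q :=
      funext fun Q => Flag.conj_mk A Q
    rw [this, ← Measure.map_map Flag.continuous_mk.measurable (measurable_const_mul A),
      map_mul_left_eq_self]
  exact ⟨_, hν, fun ν' hν' => by rw [hν'.eq_map μ.inv, ← hν.eq_map μ.inv]⟩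

/-- The image of a closed set of group elements and all strictly decreasing spectra is Borel. -/
theorem measurableSet_ordered_conj {C : Set (UnitaryGp n F)} (hC : IsClosed C) :
    MeasurableSet {X : SelfAdj n F | ∃ Q ∈ C, ∃ l, IsOrderedEigendecomposition X Q l} := by
  have hopen : IsOpen {l : Fin n → ℝ | StrictAnti l} := by
    have : {l : Fin n → ℝ | StrictAnti l} = ⋂ i, ⋂ j, {l | i < j → l j < l i} := by
      ext l
      simp [StrictAnti]
    rw [this]
    refine isOpen_iInter_of_finite fun i => isOpen_iInter_of_finite fun j => ?_
    by_cases h : i < j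
    · simpa [h] using isOpen_lt (continuous_apply j) (continuous_apply i)
    · simp [h]
  have : LocallyCompactSpace {l : Fin n → ℝ | StrictAnti l} := hopen.locallyCompactSpace
  have : CompactSpace C := isCompact_iff_compactSpace.1 hC.isCompact
  let f : C × {l : Fin n → ℝ | StrictAnti l} → Matrix (Fin n) (Fin n) F := fun q =>
    q.1.1.1 * realDiag q.2.1 * q.1.1.1ᴴ
  have hf : Continuous f := by
    have : Continuous fun l : {l : Fin n → ℝ | StrictAnti l} =>
        (realDiag l.1 : Matrix (Fin n) (Fin n) F) := by
      refine Continuous.matrix_diagonal (continuous_pi fun i => ?_)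
      exact ((continuous_apply i).comp continuous_subtype_val).smul continuous_const
    have h1 : Continuous fun q : C × {l : Fin n → ℝ | StrictAnti l} => q.1.1.1 := by fun_prop
    exact (h1.mul (this.comp continuous_snd)).mul h1.matrix_conjTranspose
  -- The parameter space is σ-compact: a compact set times an open subset of ℝⁿ. Its continuous
  -- image is thus a countable union of compact sets.
  obtain ⟨K, hK, hKf⟩ := isSigmaCompact_range hf
  have hm : MeasurableSet (Set.range f) := hKf ▸ MeasurableSet.iUnion fun i => (hK i).measurableSet
  convert measurable_subtype_coe hm using 1
  ext X
  constructor
  · rintro ⟨Q, hQ, l, hl, hX⟩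
    exact ⟨(⟨Q, hQ⟩, ⟨l, hl⟩), hX.symm⟩
  · rintro ⟨⟨⟨Q, hQ⟩, ⟨l, hl⟩⟩, hX⟩
    exact ⟨Q, hQ, l, hl, hX.symm⟩

/-- `phi` is defined by choice, but by well-definedness "the chosen Q lies over C" is equivalent to
"some Q lies over C". The preimage of a closed set is then a Borel set of decomposable matrices,
together with the non-decomposable ones if the default value lies in C. -/
theorem measurable_phi (k : Fin p → ℕ) (a : Fin (p + 1) → ℝ) :
    Measurable (phi k a : SelfAdj n F → Flag n F k a) := by
  refine measurable_of_isClosed fun C hC => ?_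
  have h1 := measurableSet_ordered_conj (n := n) (F := F) (hC.preimage (Flag.continuous_mk (k := k) (a := a)))
  have h2 := (measurableSet_ordered_conj (n := n) (F := F) isClosed_univ).compl
  have h3 : phi k a ⁻¹' C =
      {X : SelfAdj n F | ∃ Q ∈ Flag.mk k a ⁻¹' C, ∃ l, IsOrderedEigendecomposition X Q l} ∪
        ({X : SelfAdj n F | ∃ Q ∈ Set.univ, ∃ l, IsOrderedEigendecomposition X Q l}ᶜ ∩
          {_X | Flag.mk k a 1 ∈ C}) := by
    ext X
    by_cases h : ∃ Q l, IsOrderedEigendecomposition X Q l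
    · obtain ⟨Q, l, hQ⟩ := h
      simp only [Set.mem_preimage, Set.mem_union, Set.mem_inter_iff, Set.mem_compl_iff,
        Set.mem_ofPred_eq]
      constructor
      · intro hX
        exact Or.inl ⟨Q, by rwa [← hQ.phi_eq k a], l, hQ⟩
      · rintro (⟨Q', hQ', l', h'⟩ | ⟨h', -⟩)
        · rwa [h'.phi_eq k a]
        · exact absurd ⟨Q, trivial, l, hQ⟩ h'
    · have h0 : phi k a X = Flag.mk k a 1 := dif_neg h
      simp only [Set.mem_preimage, Set.mem_union, Set.mem_inter_iff, Set.mem_compl_iff,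
        Set.mem_ofPred_eq, h0]
      constructor
      · exact fun hX => Or.inr ⟨fun ⟨Q, _, l, hQ⟩ => h ⟨Q, l, hQ⟩, hX⟩
      · rintro (⟨Q', _, l', h'⟩ | ⟨-, h'⟩)
        · exact absurd ⟨Q', l', h'⟩ h
        · exact h'
  rw [h3]
  exact h1.union (h2.inter (MeasurableSet.const _))

variable [StarModule ℝ F] [MeasurableSpace F] [BorelSpace F]

/-- The parametrization of the self-adjoint matrices as a homeomorphism. -/
noncomputable def coordsHomeomorph :
    ((Fin n → ℝ) × ({q : Fin n × Fin n // q.1 < q.2} → F)) ≃ₜ SelfAdj n F where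
  toEquiv := (coordsEquiv (n := n) (F := F)).toEquiv
  continuous_toFun := continuous_coordsEquiv
  continuous_invFun := continuous_coordsEquiv_symm

/-- Sweeping a compact neighbourhood of 0 by the compact group keeps it compact and makes it
invariant. -/
theorem exists_compact_conj_invariant_nhds :
    ∃ K : Set (SelfAdj n F), IsCompact K ∧ K ∈ nhds 0 ∧
      ∀ A : UnitaryGp n F, conjSelfAdj A ⁻¹' K = K := by
  have : ProperSpace F := FiniteDimensional.proper ℝ F
  have : LocallyCompactSpace (SelfAdj n F) :=
    (coordsHomeomorph (n := n) (F := F)).symm.isClosedEmbedding.locallyCompactSpace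
  obtain ⟨C, hC, hC0⟩ := exists_compact_mem_nhds (0 : SelfAdj n F)
  refine ⟨(fun q : UnitaryGp n F × SelfAdj n F => conjSelfAdj q.1 q.2) '' (Set.univ ×ˢ C),
    (isCompact_univ.prod hC).image continuous_conjSelfAdj_uncurry,
    Filter.mem_of_superset hC0 fun X hX => ⟨(1, X), ⟨trivial, hX⟩, conjSelfAdj_one X⟩,
    fun A => ?_⟩
  ext X
  constructor
  · rintro ⟨⟨B, Y⟩, ⟨-, hY⟩, h⟩
    refine ⟨(A⁻¹ * B, Y), ⟨trivial, hY⟩, ?_⟩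
    simp only at h ⊢
    rw [conjSelfAdj_mul, h, ← conjSelfAdj_mul, inv_mul_cancel, conjSelfAdj_one]
  · rintro ⟨⟨B, Y⟩, ⟨-, hY⟩, rfl⟩
    exact ⟨(A * B, Y), ⟨trivial, hY⟩, conjSelfAdj_mul A B Y⟩

/-- The pushforward is again a Haar measure, hence c times Lebesgue measure. An invariant compact
neighbourhood of 0 has finite positive measure, which forces c = 1 with no Jacobian computed. -/
theorem measurePreserving_conjSelfAdj (A : UnitaryGp n F) :
    MeasurePreserving (conjSelfAdj A) (lebesgue n F) (lebesgue n F) := by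
  refine ⟨(continuous_conjSelfAdj A).measurable, ?_⟩
  have : ProperSpace F := FiniteDimensional.proper ℝ F
  have : LocallyCompactSpace (SelfAdj n F) :=
    (coordsHomeomorph (n := n) (F := F)).symm.isClosedEmbedding.locallyCompactSpace
  have : SecondCountableTopology (SelfAdj n F) :=
    (coordsHomeomorph (n := n) (F := F)).symm.isEmbedding.secondCountableTopology
  have hmap : ((lebesgue n F).map (conjSelfAdj A)).IsAddHaarMeasure :=
    AddEquiv.isAddHaarMeasure_map (lebesgue n F) (conjAddEquiv A) (continuous_conjSelfAdj A)
      (continuous_conjSelfAdj A⁻¹)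
  obtain ⟨K, hK, hK0, hKA⟩ := exists_compact_conj_invariant_nhds (n := n) (F := F)
  have h := Measure.isAddLeftInvariant_eq_smul ((lebesgue n F).map (conjSelfAdj A)) (lebesgue n F)
  set c := Measure.addHaarScalarFactor ((lebesgue n F).map (conjSelfAdj A)) (lebesgue n F)
  have h1 := congrArg (fun μ : Measure (SelfAdj n F) => μ K) h
  simp only [Measure.smul_apply] at h1
  rw [Measure.map_apply (continuous_conjSelfAdj A).measurable hK.measurableSet, hKA] at h1
  have hpos : lebesgue n F K ≠ 0 := (Measure.measure_pos_of_mem_nhds _ hK0).ne'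
  have hfin : lebesgue n F K ≠ ⊤ := hK.measure_ne_top
  have hc : (c : ENNReal) = 1 := by
    refine (ENNReal.mul_eq_right hpos hfin).1 ?_
    exact h1.symm
  rw [h, ENNReal.coe_eq_one.1 hc, one_smul]

theorem gaussianDensity_conjSelfAdj (A : UnitaryGp n F) (X : SelfAdj n F) :
    gaussianDensity (conjSelfAdj A X) = gaussianDensity X := by
  have h : (conjSelfAdj A X).1 * (conjSelfAdj A X).1 = A.1 * (X.1 * X.1 * A.1ᴴ) := by
    calc A.1 * X.1 * A.1ᴴ * (A.1 * X.1 * A.1ᴴ) = A.1 * X.1 * (A.1ᴴ * A.1) * X.1 * A.1ᴴ := by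
          simp only [Matrix.mul_assoc]
      _ = A.1 * (X.1 * X.1 * A.1ᴴ) := by
          rw [conjTranspose_mul_self, Matrix.mul_one]
          simp only [Matrix.mul_assoc]
  simp only [gaussianDensity]
  rw [← reTrace_apply, ← reTrace_apply, h, reTrace_mul_comm, Matrix.mul_assoc,
    conjTranspose_mul_self, Matrix.mul_one]

theorem continuous_gaussianDensity : Continuous (gaussianDensity : SelfAdj n F → ℝ) := by
  have : Continuous fun X : SelfAdj n F => reTrace (X.1 * X.1) :=
    continuous_reTrace.comp (continuous_subtype_val.mul continuous_subtype_val)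
  exact continuous_const.mul (Real.continuous_exp.comp ((this.neg).div_const 2))

theorem map_conjSelfAdj_gaussianEnsemble (A : UnitaryGp n F) :
    (gaussianEnsemble n F).map (conjSelfAdj A) = gaussianEnsemble n F := by
  have hA := measurePreserving_conjSelfAdj A
  have hf : Measurable fun X : SelfAdj n F => ENNReal.ofReal (gaussianDensity X) :=
    ENNReal.measurable_ofReal.comp continuous_gaussianDensity.measurable
  ext s hs
  rw [Measure.map_apply hA.measurable hs, gaussianEnsemble,
    withDensity_apply _ (hA.measurable hs), withDensity_apply _ hs,
    ← hA.setLIntegral_comp_preimage hs hf]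
  simp only [gaussianDensity_conjSelfAdj]

theorem isInvariantDistribution_map_phi [IsProbabilityMeasure (gaussianEnsemble n F)]
    (k : Fin p → ℕ) (a : Fin (p + 1) → ℝ) :
    IsInvariantDistribution ((gaussianEnsemble n F).map (phi k a)) := by
  refine ⟨Measure.isProbabilityMeasure_map (measurable_phi k a).aemeasurable, fun A => ?_⟩
  have hA := (continuous_conjSelfAdj A).measurable
  rw [Measure.map_map (Flag.measurable_conj A) (measurable_phi k a)]
  conv_rhs => rw [← map_conjSelfAdj_gaussianEnsemble A, Measure.map_map (measurable_phi k a) hA]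
  -- Equivariance of `phi` may fail at the default value, so the two maps are compared only almost
  -- everywhere.
  refine Measure.map_congr ?_
  filter_upwards [ae_gaussianEnsemble_mem_simpleSpectrum (n := n) (F := F)] with X hX
  obtain ⟨Q, l, h⟩ := exists_isOrderedEigendecomposition hX
  exact (h.phi_conj A).symm

theorem gaussianEnsemble_flag (k : Fin p → ℕ) (a : Fin (p + 1) → ℝ)
    {Ω : Type*} [MeasurableSpace Ω] (P : Measure Ω) [IsProbabilityMeasure P] :
    (∀ X ∈ simpleSpectrum n F, (∃ Q l, IsOrderedEigendecomposition X Q l) ∧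
      ∀ Q l, IsOrderedEigendecomposition X Q l → phi k a X = Flag.mk k a Q) ∧
    (∀ᵐ X ∂(gaussianEnsemble n F), X ∈ simpleSpectrum n F) ∧
    ∃ ν : Measure (Flag n F k a), IsUniformDistribution ν ∧
      ∀ X : Ω → SelfAdj n F, HasLaw X (gaussianEnsemble n F) P →
        HasLaw (fun ω => phi k a (X ω)) ν P := by
  refine ⟨fun X hX => ⟨exists_isOrderedEigendecomposition hX, fun Q l h => h.phi_eq k a⟩,
    ae_gaussianEnsemble_mem_simpleSpectrum, ?_⟩
  obtain ⟨ν, hν⟩ := exists_isUniformDistribution (n := n) (F := F) k a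
  refine ⟨ν, hν, fun X hX => ?_⟩
  -- Total mass 1 is inherited from P through the law of X; the Gaussian integral is not evaluated.
  have : IsProbabilityMeasure (gaussianEnsemble n F) :=
    hX.isProbabilityMeasure_iff.1 inferInstance
  exact HasLaw.fun_comp ⟨(measurable_phi k a).aemeasurable,
    hν.2 _ (isInvariantDistribution_map_phi k a)⟩ hX

end General

end GaussianFlag

theorem mainTheorem1 {n p : ℕ} (k : Fin p → ℕ) (hk : StrictMono k)
    (hk_pos : ∀ j, 0 < k j) (hk_lt : ∀ j, k j < n)
    (a : Fin (p + 1) → ℝ) (ha : Function.Injective a)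
    {Ω : Type*} [MeasurableSpace Ω] (P : Measure Ω) [IsProbabilityMeasure P] :
    -- real case
    ((∀ X ∈ GaussianFlag.simpleSpectrum n ℝ,
        (∃ Q l, GaussianFlag.IsOrderedEigendecomposition X Q l) ∧
        ∀ Q l, GaussianFlag.IsOrderedEigendecomposition X Q l →
          GaussianFlag.phi k a X = GaussianFlag.Flag.mk k a Q) ∧
      (∀ᵐ X ∂(GaussianFlag.GOE n), X ∈ GaussianFlag.simpleSpectrum n ℝ) ∧
      ∃ ν : Measure (GaussianFlag.Flag n ℝ k a), GaussianFlag.IsUniformDistribution ν ∧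
        ∀ X : Ω → GaussianFlag.SelfAdj n ℝ, HasLaw X (GaussianFlag.GOE n) P →
          HasLaw (fun ω => GaussianFlag.phi k a (X ω)) ν P) ∧
    -- complex case
    ((∀ X ∈ GaussianFlag.simpleSpectrum n ℂ,
        (∃ Q l, GaussianFlag.IsOrderedEigendecomposition X Q l) ∧
        ∀ Q l, GaussianFlag.IsOrderedEigendecomposition X Q l →
          GaussianFlag.phi k a X = GaussianFlag.Flag.mk k a Q) ∧
      (∀ᵐ X ∂(GaussianFlag.GUE n), X ∈ GaussianFlag.simpleSpectrum n ℂ) ∧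
      ∃ ν : Measure (GaussianFlag.Flag n ℂ k a), GaussianFlag.IsUniformDistribution ν ∧
        ∀ X : Ω → GaussianFlag.SelfAdj n ℂ, HasLaw X (GaussianFlag.GUE n) P →
          HasLaw (fun ω => GaussianFlag.phi k a (X ω)) ν P) ∧
    -- quaternionic case
    ((∀ X ∈ GaussianFlag.simpleSpectrum n ℍ[ℝ],
        (∃ Q l, GaussianFlag.IsOrderedEigendecomposition X Q l) ∧
        ∀ Q l, GaussianFlag.IsOrderedEigendecomposition X Q l →
          GaussianFlag.phi k a X = GaussianFlag.Flag.mk k a Q) ∧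
      (∀ᵐ X ∂(GaussianFlag.GSE n), X ∈ GaussianFlag.simpleSpectrum n ℍ[ℝ]) ∧
      ∃ ν : Measure (GaussianFlag.Flag n ℍ[ℝ] k a), GaussianFlag.IsUniformDistribution ν ∧
        ∀ X : Ω → GaussianFlag.SelfAdj n ℍ[ℝ], HasLaw X (GaussianFlag.GSE n) P →
          HasLaw (fun ω => GaussianFlag.phi k a (X ω)) ν P) := by
  exact ⟨GaussianFlag.gaussianEnsemble_flag k a P, GaussianFlag.gaussianEnsemble_flag k a P,
    GaussianFlag.gaussianEnsemble_flag k a P⟩
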